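/- All graphs are finite, undirected and simple. A connected graph $\Gamma$ of diameter $D$ with distance function $d$ is distance-regular if there are integers $b_i,c_i$ $(0\le i\le D)$ such that for any two vertices $x,y$ with $d(x,y)=i$ there are exactly $c_i$ neighbours $z$ of $y$ with $d(x,z)=i-1$ and exactly $b_i$ neighbours $z$ of $y$ with $d(x,z)=i+1$; put $k=b_0$ (the valency) and $a_i=b_0-b_i-c_i$. Such a graph has exactly $D+1$ distinct (adjacency) eigenvalues $\theta_0>\theta_1>\cdots>\theta_D$. Let $E_i$, the minimal idempotent corresponding to $\theta_i$, be the matrix of the orthogonal projection onto the eigenspace of $\theta_i$; thus $E_0=\frac1n J$, where $n$ is the number of vertices and $J$ is the all-one matrix. A minimal idempotent $E$ is a light tail with associated minimal idempotent $F$ if $F\ne E_0$ is a minimal idempotent and $E\circ E=aE_0+bF$ for some non-zero real numbers $a,b$, where $\circ$ is the entrywise product. For positive integers $s,t$, a generalized quadrangle $GQ(s,t)$ is a distance-regular graph of diameter $2$ with intersection array $\{b_0,b_1;c_1,c_2\}=\{(t+1)s,\,ts;\,1,\,t+1\}$ and without induced subgraph isomorphic to $K_{2,1,1}$. **Theorem.**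 Let $\Gamma$ be a distance-regular graph with valency $k\ge 3$, diameter $D\ge 2$, $a_1\ne 0$ and distinct eigenvalues $\theta_0>\theta_1>\cdots>\theta_D=-\frac{k}{a_1+1}$. Suppose that $c_2=(a_1+1)^2+1$ and that $\Gamma$ contains a $GQ(a_1+1,c_2-1)$ as an induced subgraph. Then $$\theta_1=\frac{k-(a_1+1)(a_1+2)}{(a_1+1)^2},$$ and $E_D$ is a light tail with associated minimal idempotent $E_1$. -/

import Mathlib

open scoped Matrix

namespace LightTail

/-- `G` is a distance-regular graph with diameter `D` and intersection numbers `b i`, `c i`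
(`0 ≤ i ≤ D`): `G` is connected of diameter `D`, and for any two vertices `x`, `y` at distance `i`
there are exactly `c i` neighbours of `y` at distance `i - 1` from `x` and exactly `b i` neighbours
of `y` at distance `i + 1` from `x`. (So `c 0 = 0` and `b D = 0`; the values of `b` and `c`
beyond `D` carry no information.) -/
structure IsDistanceRegular {V : Type*} (G : SimpleGraph V) (D : ℕ) (b c : ℕ → ℕ) : Prop where
  connected : G.Connected
  diam_eq : G.diam = D
  ncard_c : ∀ x y : V, {z | G.Adj y z ∧ G.dist x z + 1 = G.dist x y}.ncard = c (G.dist x y)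
  ncard_b : ∀ x y : V, {z | G.Adj y z ∧ G.dist x z = G.dist x y + 1}.ncard = b (G.dist x y)

/-- The intersection number `a i = b 0 - b i - c i`; no truncation takes place for `i ≤ D`,
see `interA_spec`. -/
def interA (b c : ℕ → ℕ) (i : ℕ) : ℕ := b 0 - b i - c i

/-- For `x`, `y` at distance `i`, the subtractions in `interA b c i` do not truncate. -/
theorem interA_spec {V : Type*} [Finite V] {G : SimpleGraph V} {D : ℕ} {b c : ℕ → ℕ}
    (h : IsDistanceRegular G D b c) (x y : V) :
    interA b c (G.dist x y) + b (G.dist x y) + c (G.dist x y) = b 0 := by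
  have h1 : {z | G.Adj y z}.ncard = b 0 := by
    have h0 := h.ncard_b y y
    rw [SimpleGraph.dist_self] at h0
    rw [← h0]
    congr 1
    ext z
    simp [SimpleGraph.dist_eq_one_iff_adj]
  have hd : Disjoint {z | G.Adj y z ∧ G.dist x z + 1 = G.dist x y}
      {z | G.Adj y z ∧ G.dist x z = G.dist x y + 1} := by
    rw [Set.disjoint_left]
    rintro z ⟨_, h2⟩ ⟨_, h3⟩
    omega
  have h2 := Set.ncard_le_ncard (s := {z | G.Adj y z ∧ G.dist x z + 1 = G.dist x y} ∪
      {z | G.Adj y z ∧ G.dist x z = G.dist x y + 1}) (t := {z | G.Adj y z})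
      (by rintro z (h | h) <;> exact h.1) (Set.toFinite _)
  rw [Set.ncard_union_eq hd (Set.toFinite _) (Set.toFinite _), h.ncard_b, h.ncard_c, h1] at h2
  unfold interA
  omega

/-- The complete multipartite graph `K_{2,1,1}`. -/
abbrev K211 : SimpleGraph (Σ i : Fin 3, Fin (![2, 1, 1] i)) :=
  SimpleGraph.completeMultipartiteGraph fun i : Fin 3 => Fin (![2, 1, 1] i)

/-- `G` is a generalized quadrangle `GQ(s, t)` of order `(s, t)`, with `s`, `t` positive integers:
a distance-regular graph of diameter `2` with intersection array `{(t + 1)s, ts; 1, t + 1}` that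
has no induced subgraph isomorphic to `K_{2,1,1}`. -/
structure IsGQ {V : Type*} (G : SimpleGraph V) (s t : ℕ) : Prop where
  s_pos : 0 < s
  t_pos : 0 < t
  k211_free : ¬ K211.IsIndContained G
  distanceRegular : ∃ b c : ℕ → ℕ, IsDistanceRegular G 2 b c ∧
    b 0 = (t + 1) * s ∧ b 1 = t * s ∧ c 1 = 1 ∧ c 2 = t + 1

section Spectral

variable {V : Type*} [Fintype V] [DecidableEq V] (G : SimpleGraph V) [DecidableRel G.Adj]

/-- The set of eigenvalues of `G`, i.e. of its adjacency matrix. -/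
def eigenvalues : Set ℝ :=
  {μ | Module.End.HasEigenvalue (Matrix.toEuclideanLin (G.adjMatrix ℝ)) μ}

/-- The eigenspace of the adjacency matrix of `G` for the real number `μ`. -/
noncomputable def eigenspace (μ : ℝ) : Submodule ℝ (EuclideanSpace ℝ V) :=
  Module.End.eigenspace (Matrix.toEuclideanLin (G.adjMatrix ℝ)) μ

/-- The minimal idempotent of `G` corresponding to the eigenvalue `μ`: the matrix of the orthogonal
projection of `ℝ^V` onto the eigenspace of `μ`. -/
noncomputable def minimalIdempotent (μ : ℝ) : Matrix V V ℝ :=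
  Matrix.toEuclideanLin.symm
    ((eigenspace G μ).starProjection : EuclideanSpace ℝ V →ₗ[ℝ] EuclideanSpace ℝ V)

/-- The minimal idempotent is `W * Wᵀ`, where the columns of `W` form any orthonormal basis of the
eigenspace. -/
theorem minimalIdempotent_eq_mul_transpose (μ : ℝ) {ι : Type*} [Fintype ι]
    (w : OrthonormalBasis ι ℝ (eigenspace G μ)) :
    minimalIdempotent G μ =
      (Matrix.of fun x i => (w i : EuclideanSpace ℝ V) x) *
        (Matrix.of fun x i => (w i : EuclideanSpace ℝ V) x)ᵀ := by
  ext x y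
  rw [minimalIdempotent, w.starProjection_eq_sum_rankOne]
  simp [Matrix.sum_apply, Matrix.mul_apply, InnerProductSpace.symm_toEuclideanLin_rankOne,
    Matrix.vecMulVec_apply, ContinuousLinearMap.toLinearMap_sum]

/-- `E` is a minimal idempotent of `G`. -/
def IsMinimalIdempotent (E : Matrix V V ℝ) : Prop :=
  ∃ μ ∈ eigenvalues G, E = minimalIdempotent G μ

variable (V) in
/-- `E₀ = (1/n) J`, where `n` is the number of vertices and `J` is the all-one matrix. -/
noncomputable def E₀ : Matrix V V ℝ := (Fintype.card V : ℝ)⁻¹ • Matrix.of fun _ _ => 1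

/-- The minimal idempotent `E` of `G` is a light tail with associated minimal idempotent `F`:
`F ≠ E₀` is a minimal idempotent of `G`, and the entrywise product of `E` with itself is
`a E₀ + b F` for some non-zero real numbers `a`, `b`. -/
def IsLightTailWith (E F : Matrix V V ℝ) : Prop :=
  IsMinimalIdempotent G E ∧ IsMinimalIdempotent G F ∧ F ≠ E₀ V ∧
    ∃ a b : ℝ, a ≠ 0 ∧ b ≠ 0 ∧ E ⊙ E = a • E₀ V + b • F

end Spectral

end LightTail

/-!
Put `s = a₁ + 1`, and let `X` be the idempotent of `θ D = -k / s`, scaled to have unit diagonal.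
Being a polynomial in the adjacency matrix, it has entries `ω (dist x y)`, and it is the Gram matrix
of unit vectors `x̂` indexed by the vertices. The three-term recurrence gives `ω 1 = -1 / s` and
`ω 2 = 1 / s ^ 2`.

The geometry is forced by two vectors of norm zero. If `x`, `y` are at distance two, then, since
`c 2 = s ^ 2 + 1`, the norm of `s (x̂ + ŷ) + ∑ ẑ` (over the common neighbours `z`) is at most zero,
and it would be negative if two of the `z` were adjacent. Hence this vector vanishes and common
neighbours of non-adjacent vertices are pairwise non-adjacent
(`IsTailGram.relation_of_dist_eq_two`). It follows that an edge together with its common neighbours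
is a clique, whose vectors then also sum to zero (`IsTailGram.relation_of_adj`).

The first relation, tested against a vertex far away, yields `ω i = (-1 / s) ^ i`
(`IsTailGram.omega_eq`). Together the relations show that the vectors of the closed neighbourhood of
any vertex form a weighted tight frame (`IsTailGram.sum_neighborFinset_mul`). Read off on the
diagonal, this says that the entrywise square `X ∘ X` is mapped by the adjacency matrix to
`τ (X ∘ X) + ((s + 1) / s) J` with `τ = (k - s (s + 1)) / s ^ 2`. Subtracting a multiple of `J`
leaves a matrix whose columns are eigenvectors for `τ` and whose entries depend only on the
distance, so a multiple of the idempotent of `τ`: this is the light tail property.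

Finally `τ = θ 1`. The sequence `ω i ^ 2 = s ^ (-2 i)` is strictly decreasing. For every eigenvalue
other than `k`, the differences of consecutive values of its sequence form an eigenvector of one and
the same tridiagonal matrix with non-negative off-diagonal entries. That of `τ` has constant sign,
so `τ` is the largest of these eigenvalues
(`IsDistanceRegular.le_of_isEigenseq_of_strictAnti`).
-/

namespace LightTail

open Finset

/-! ### Distance-regular graphs -/

section Graph

variable {V : Type*} {G : SimpleGraph V} {D : ℕ} {b c : ℕ → ℕ}

/-- The three-term recurrence, for `0 ≤ i ≤ D`, that a function of the distance to a fixed vertex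
satisfies when it is an eigenvector of the adjacency matrix for `μ`. At the ends, `f (0 - 1) = f 0`
and `f (D + 1)` are harmless, because `c 0 = 0` and `b D = 0`. -/
def IsEigenseq (D : ℕ) (b c : ℕ → ℕ) (μ : ℝ) (f : ℕ → ℝ) : Prop :=
  ∀ i ≤ D, (c i : ℝ) * f (i - 1) + ((b 0 : ℝ) - b i - c i) * f i + (b i : ℝ) * f (i + 1) = μ * f i

theorem exists_adj_dist_eq (hG : G.Connected) {x y : V} {n : ℕ} (h : G.dist x y = n + 1) :
    ∃ z, G.Adj y z ∧ G.dist x z = n := by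
  obtain ⟨p, hp⟩ := hG.exists_walk_length_eq_dist y x
  rw [G.dist_comm, h] at hp
  cases p with
  | nil => simp at hp
  | @cons _ z _ hz q =>
    refine ⟨z, hz, ?_⟩
    simp only [SimpleGraph.Walk.length_cons, Nat.add_right_cancel_iff] at hp
    have h1 := G.dist_le q
    rw [G.dist_comm] at h1
    have h2 := hG.dist_triangle (u := x) (v := z) (w := y)
    rw [SimpleGraph.dist_eq_one_iff_adj.2 hz.symm] at h2
    omega

theorem dist_le_of_adj (hG : G.Connected) (x : V) {y z : V} (h : G.Adj y z) :
    G.dist x z ≤ G.dist x y + 1 := by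
  have h2 := hG.dist_triangle (u := x) (v := y) (w := z)
  rwa [SimpleGraph.dist_eq_one_iff_adj.2 h] at h2

namespace IsDistanceRegular

theorem exists_dist_eq (hG : IsDistanceRegular G D b c) {i : ℕ} (hi : i ≤ D) :
    ∃ x y, G.dist x y = i := by
  have := hG.connected.nonempty
  induction hi using Nat.decreasingInduction with
  | self =>
    obtain ⟨x, y, h⟩ := G.exists_dist_eq_diam
    exact ⟨x, y, h.trans hG.diam_eq⟩
  | of_succ i _ ih =>
    obtain ⟨x, y, h⟩ := ih
    obtain ⟨z, -, hz⟩ := exists_adj_dist_eq hG.connected h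
    exact ⟨x, z, hz⟩

theorem c_zero (hG : IsDistanceRegular G D b c) : c 0 = 0 := by
  obtain ⟨x⟩ := hG.connected.nonempty
  have h := hG.ncard_c x x
  rw [G.dist_self] at h
  simpa using h.symm

theorem c_one (hG : IsDistanceRegular G D b c) (hD : 1 ≤ D) : c 1 = 1 := by
  obtain ⟨x, y, h⟩ := hG.exists_dist_eq hD
  have h1 := hG.ncard_c x y
  have h2 : {z | G.Adj y z ∧ G.dist x z + 1 = G.dist x y} = {x} := by
    ext z
    simp only [Set.mem_ofPred_eq, Set.mem_singleton_iff, h, Nat.add_eq_right,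
      hG.connected.dist_eq_zero_iff]
    constructor
    · rintro ⟨_, rfl⟩
      rfl
    · rintro rfl
      exact ⟨(SimpleGraph.dist_eq_one_iff_adj.1 h).symm, rfl⟩
  rw [h2, Set.ncard_singleton, h] at h1
  exact h1.symm

/-- The difference sequence `h i = f i - f (i + 1)`, for `0 ≤ i < D`, is an eigenvector of a
tridiagonal matrix with non-negative off-diagonal entries `c i`, `b (i + 1)` and diagonal entries
`b 0 - b i - c (i + 1)`. -/
theorem isEigenseq_sub (hG : IsDistanceRegular G D b c) {μ : ℝ} {f : ℕ → ℝ}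
    (hf : IsEigenseq D b c μ f) {i : ℕ} (hi : i < D) :
    (c i : ℝ) * (f (i - 1) - f (i - 1 + 1)) + (b (i + 1) : ℝ) * (f (i + 1) - f (i + 2)) =
      (μ - ((b 0 : ℝ) - b i - c (i + 1))) * (f i - f (i + 1)) := by
  have h1 := hf i hi.le
  have h2 := hf (i + 1) hi
  rw [Nat.add_sub_cancel] at h2
  have h3 : (c i : ℝ) * f (i - 1 + 1) = c i * f i := by
    rcases i with _ | i
    · simp [hG.c_zero]
    · rfl
  linear_combination h1 - h2 - h3

/-- Only the valency has a sequence with `f 0 = f 1 ≠ 0`. -/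
theorem eq_valency_of_isEigenseq (hG : IsDistanceRegular G D b c) {μ : ℝ} {f : ℕ → ℝ}
    (hf : IsEigenseq D b c μ f) (h0 : f 0 ≠ 0) (h01 : f 0 = f 1) : μ = b 0 := by
  have h := hf 0 (Nat.zero_le _)
  rw [hG.c_zero, ← h01] at h
  refine mul_right_cancel₀ h0 ?_
  rw [← h]
  simp

variable [Fintype V]

theorem dist_le (hG : IsDistanceRegular G D b c) (x y : V) : G.dist x y ≤ D := by
  have := hG.connected.nonempty
  have h := SimpleGraph.dist_le_diam (SimpleGraph.connected_iff_ediam_ne_top.1 hG.connected)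
    (u := x) (v := y)
  rwa [hG.diam_eq] at h

theorem b_diam (hG : IsDistanceRegular G D b c) : b D = 0 := by
  obtain ⟨x, y, h⟩ := hG.exists_dist_eq le_rfl
  have h1 := hG.ncard_b x y
  rw [h] at h1
  rw [← h1, Set.ncard_eq_zero]
  ext z
  have := hG.dist_le x z
  simp only [Set.mem_ofPred_eq, Set.mem_empty_iff_false, iff_false]
  omega

theorem b_pos (hG : IsDistanceRegular G D b c) {i : ℕ} (hi : i < D) : 0 < b i := by
  obtain ⟨x, y, h⟩ := hG.exists_dist_eq (Nat.succ_le_of_lt hi)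
  obtain ⟨z, hz, hz'⟩ := exists_adj_dist_eq hG.connected h
  have h1 := hG.ncard_b x z
  rw [hz'] at h1
  rw [← h1]
  exact (Set.ncard_pos (Set.toFinite _)).2 ⟨y, hz.symm, h⟩

/-- A sequence satisfying the three-term recurrence is determined by its value at `0`. -/
theorem eq_zero_of_isEigenseq (hG : IsDistanceRegular G D b c) {μ : ℝ} {f : ℕ → ℝ}
    (hf : IsEigenseq D b c μ f) (h0 : f 0 = 0) :
    ∀ i ≤ D, f i = 0 := by
  intro i
  induction i using Nat.strong_induction_on with
  | _ i ih =>
    intro hi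
    rcases i with _ | i
    · exact h0
    · have h1 := hf i (by omega)
      rw [ih (i - 1) (by omega) (by omega), ih i (by omega) (by omega)] at h1
      have h2 : (b i : ℝ) ≠ 0 := by exact_mod_cast (hG.b_pos hi).ne'
      simpa [h2] using h1

/-- Two sequences for the same eigenvalue are proportional. -/
theorem mul_eq_mul_of_isEigenseq (hG : IsDistanceRegular G D b c) {μ : ℝ} {f g : ℕ → ℝ}
    (hf : IsEigenseq D b c μ f) (hg : IsEigenseq D b c μ g) {i : ℕ} (hi : i ≤ D) :
    f 0 * g i = g 0 * f i := by
  refine sub_eq_zero.1 (hG.eq_zero_of_isEigenseq (μ := μ)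
    (f := fun i => f 0 * g i - g 0 * f i) (fun j hj => ?_) (by ring) i hi)
  linear_combination f 0 * hg j hj - g 0 * hf j hj

/-- If an eigenvalue `τ` has a strictly decreasing sequence, then every eigenvalue with a
non-constant sequence is at most `τ`: the differences of the former are a positive eigenvector of
a matrix with non-negative off-diagonal entries, so `τ` is the largest eigenvalue of that matrix. -/
theorem le_of_isEigenseq_of_strictAnti (hG : IsDistanceRegular G D b c) {μ τ : ℝ} {f g : ℕ → ℝ}
    (hf : IsEigenseq D b c μ f) (hg : IsEigenseq D b c τ g) (hanti : ∀ i < D, g (i + 1) < g i)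
    (hconst : ∃ i < D, f i ≠ f (i + 1)) : μ ≤ τ := by
  obtain ⟨j, hj, hfj⟩ := hconst
  -- maximise the ratio of the differences of `f` and `g`
  obtain ⟨i, hi, hmax⟩ := exists_max_image (range D)
    (fun i => |f i - f (i + 1)| / (g i - g (i + 1))) ⟨j, mem_range.2 hj⟩
  rw [mem_range] at hi
  set ρ := |f i - f (i + 1)| / (g i - g (i + 1)) with hρ
  have hgpos : ∀ l < D, 0 < g l - g (l + 1) := fun l hl => sub_pos.2 (hanti l hl)
  have hle : ∀ l < D, |f l - f (l + 1)| ≤ ρ * (g l - g (l + 1)) := fun l hl =>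
    (div_le_iff₀ (hgpos l hl)).1 (hmax l (mem_range.2 hl))
  have hρpos : 0 < ρ :=
    (div_pos (abs_pos.2 (sub_ne_zero.2 hfj)) (hgpos j hj)).trans_le (hmax j (mem_range.2 hj))
  have heq : |f i - f (i + 1)| = ρ * (g i - g (i + 1)) := by
    rw [hρ, div_mul_cancel₀ _ (hgpos i hi).ne']
  have hpos : 0 < |f i - f (i + 1)| := heq ▸ mul_pos hρpos (hgpos i hi)
  have e1 := hG.isEigenseq_sub hf hi
  have e2 := hG.isEigenseq_sub hg hi
  have b1 : |(c i : ℝ) * (f (i - 1) - f (i - 1 + 1))| ≤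
      ρ * ((c i : ℝ) * (g (i - 1) - g (i - 1 + 1))) := by
    rw [abs_mul, Nat.abs_cast]
    calc _ ≤ (c i : ℝ) * (ρ * (g (i - 1) - g (i - 1 + 1))) :=
          mul_le_mul_of_nonneg_left (hle _ (by omega)) (Nat.cast_nonneg _)
      _ = _ := by ring
  have b2 : |(b (i + 1) : ℝ) * (f (i + 1) - f (i + 2))| ≤
      ρ * ((b (i + 1) : ℝ) * (g (i + 1) - g (i + 2))) := by
    rcases (Nat.succ_le_of_lt hi).lt_or_eq with h | h
    · rw [abs_mul, Nat.abs_cast]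
      calc _ ≤ (b (i + 1) : ℝ) * (ρ * (g (i + 1) - g (i + 2))) :=
            mul_le_mul_of_nonneg_left (hle _ h) (Nat.cast_nonneg _)
        _ = _ := by ring
    · simp only [Nat.succ_eq_add_one] at h
      simp [h, hG.b_diam]
  have h1 := (abs_add_le _ _).trans (add_le_add b1 b2)
  rw [e1, ← mul_add, e2, abs_mul, mul_left_comm, ← heq] at h1
  have h2 := le_of_mul_le_mul_right h1 hpos
  have h3 := (le_abs_self _).trans h2
  linarith

variable [DecidableRel G.Adj]

theorem card_filter_c (hG : IsDistanceRegular G D b c) (x y : V) :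
    #{z ∈ G.neighborFinset y | G.dist x z + 1 = G.dist x y} = c (G.dist x y) := by
  rw [← hG.ncard_c x y, ← Set.ncard_coe_finset]
  congr 1
  ext z
  simp

theorem card_filter_b (hG : IsDistanceRegular G D b c) (x y : V) :
    #{z ∈ G.neighborFinset y | G.dist x z = G.dist x y + 1} = b (G.dist x y) := by
  rw [← hG.ncard_b x y, ← Set.ncard_coe_finset]
  congr 1
  ext z
  simp

theorem card_neighborFinset (hG : IsDistanceRegular G D b c) (y : V) :
    #(G.neighborFinset y) = b 0 := by
  have h := hG.card_filter_b y y
  rw [G.dist_self] at h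
  rw [← h, filter_true_of_mem]
  intro z hz
  simpa using hz

/-- Sum of a function of the distance to `x` over the neighbours of `y`. -/
theorem sum_neighborFinset (hG : IsDistanceRegular G D b c) (f : ℕ → ℝ) (x y : V) :
    ∑ z ∈ G.neighborFinset y, f (G.dist x z) =
      (c (G.dist x y) : ℝ) * f (G.dist x y - 1)
        + ((b 0 : ℝ) - b (G.dist x y) - c (G.dist x y)) * f (G.dist x y)
        + (b (G.dist x y) : ℝ) * f (G.dist x y + 1) := by
  -- the distance to `x` changes by at most one from `y` to a neighbour of `y`
  have h : ∀ z ∈ G.neighborFinset y, f (G.dist x z) = f (G.dist x y) +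
      ((if G.dist x z + 1 = G.dist x y then f (G.dist x y - 1) - f (G.dist x y) else 0) +
        if G.dist x z = G.dist x y + 1 then f (G.dist x y + 1) - f (G.dist x y) else 0) := by
    intro z hz
    rw [SimpleGraph.mem_neighborFinset] at hz
    have h1 := dist_le_of_adj hG.connected x hz
    have h2 := dist_le_of_adj hG.connected x hz.symm
    rcases (by omega : G.dist x z + 1 = G.dist x y ∨ G.dist x z = G.dist x y ∨
      G.dist x z = G.dist x y + 1) with h3 | h3 | h3
    · have h4 : G.dist x y - 1 = G.dist x z := by omega
      have h5 : G.dist x z ≠ G.dist x y + 1 := by omega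
      rw [if_pos h3, if_neg h5, h4]
      ring
    · have h4 : G.dist x z + 1 ≠ G.dist x y := by omega
      have h5 : G.dist x z ≠ G.dist x y + 1 := by omega
      rw [if_neg h4, if_neg h5, h3]
      ring
    · have h4 : G.dist x z + 1 ≠ G.dist x y := by omega
      rw [if_neg h4, if_pos h3, h3]
      ring
  rw [sum_congr rfl h, sum_add_distrib, sum_add_distrib, ← sum_filter, ← sum_filter]
  simp only [sum_const, nsmul_eq_mul, hG.card_filter_b, hG.card_filter_c, hG.card_neighborFinset]
  ring

theorem adjMatrix_mul_apply (hG : IsDistanceRegular G D b c) {M : Matrix V V ℝ} {f : ℕ → ℝ}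
    (hM : ∀ x y, M x y = f (G.dist x y)) (x y : V) :
    (G.adjMatrix ℝ * M) x y =
      (c (G.dist x y) : ℝ) * f (G.dist x y - 1)
        + ((b 0 : ℝ) - b (G.dist x y) - c (G.dist x y)) * f (G.dist x y)
        + (b (G.dist x y) : ℝ) * f (G.dist x y + 1) := by
  rw [SimpleGraph.adjMatrix_mul_apply]
  simp only [hM]
  have h := hG.sum_neighborFinset f y x
  rw [G.dist_comm (u := y)] at h
  rw [← h]
  exact sum_congr rfl fun z _ => by rw [G.dist_comm]

theorem isEigenseq_of_mul_eq_smul (hG : IsDistanceRegular G D b c) {μ : ℝ} {M : Matrix V V ℝ}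
    {f : ℕ → ℝ} (hM : ∀ x y, M x y = f (G.dist x y)) (h : G.adjMatrix ℝ * M = μ • M) :
    IsEigenseq D b c μ f := by
  intro i hi
  obtain ⟨x, y, rfl⟩ := hG.exists_dist_eq hi
  rw [← hG.adjMatrix_mul_apply hM, h, Matrix.smul_apply, hM, smul_eq_mul]

theorem mul_eq_smul_of_isEigenseq (hG : IsDistanceRegular G D b c) {μ : ℝ} {M : Matrix V V ℝ}
    {f : ℕ → ℝ} (hM : ∀ x y, M x y = f (G.dist x y)) (h : IsEigenseq D b c μ f) :
    G.adjMatrix ℝ * M = μ • M := by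
  ext x y
  rw [hG.adjMatrix_mul_apply hM, h _ (hG.dist_le x y), Matrix.smul_apply, hM, smul_eq_mul]

variable [DecidableEq V]

theorem card_commonNeighbors_of_adj (hG : IsDistanceRegular G D b c) {x y : V} (h : G.Adj x y) :
    #(G.neighborFinset x ∩ G.neighborFinset y) = interA b c 1 := by
  have h0 : G.dist x y = 1 := SimpleGraph.dist_eq_one_iff_adj.2 h
  have h1 := hG.sum_neighborFinset (fun i => if i = 1 then 1 else 0) x y
  have h2 := interA_spec hG x y
  rw [h0] at h1 h2
  have h3 : (G.neighborFinset x ∩ G.neighborFinset y) =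
      {z ∈ G.neighborFinset y | G.dist x z = 1} := by
    ext z
    simp [and_comm]
  rw [← sum_filter, ← h3] at h1
  simp at h1
  have h4 : ((interA b c 1 : ℝ)) + b 1 + c 1 = b 0 := by exact_mod_cast h2
  have h5 : ((#(G.neighborFinset x ∩ G.neighborFinset y) : ℕ) : ℝ) = interA b c 1 := by linarith
  exact_mod_cast h5

theorem card_commonNeighbors_of_dist_eq_two (hG : IsDistanceRegular G D b c) {x y : V}
    (h : G.dist x y = 2) :
    #(G.neighborFinset x ∩ G.neighborFinset y) = c 2 := by
  rw [← h, ← hG.card_filter_c x y, h]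
  congr 1
  ext z
  simp [and_comm]

end IsDistanceRegular

end Graph

/-! ### Minimal idempotents -/

section Idempotent

variable {V : Type*} [Fintype V] [DecidableEq V] {G : SimpleGraph V} [DecidableRel G.Adj]

theorem minimalIdempotent_posSemidef (μ : ℝ) : (minimalIdempotent G μ).PosSemidef := by
  rw [minimalIdempotent_eq_mul_transpose G μ (stdOrthonormalBasis ℝ (eigenspace G μ))]
  exact Matrix.posSemidef_self_mul_conjTranspose _

theorem toEuclideanLin_minimalIdempotent (μ : ℝ) (v : EuclideanSpace ℝ V) :
    Matrix.toEuclideanLin (minimalIdempotent G μ) v = (eigenspace G μ).starProjection v := by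
  rw [minimalIdempotent, LinearEquiv.apply_symm_apply]
  rfl

theorem adjMatrix_mul_minimalIdempotent (μ : ℝ) :
    G.adjMatrix ℝ * minimalIdempotent G μ = μ • minimalIdempotent G μ := by
  apply Matrix.toEuclideanLin.injective
  ext1 v
  rw [Matrix.toLpLin_mul_same, LinearMap.comp_apply, map_smul, LinearMap.smul_apply,
    toEuclideanLin_minimalIdempotent]
  exact Module.End.mem_eigenspace_iff.1 (Submodule.starProjection_apply_mem _ v)

theorem minimalIdempotent_ne_zero {μ : ℝ} (hμ : μ ∈ eigenvalues G) :
    minimalIdempotent G μ ≠ 0 := by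
  intro h
  obtain ⟨v, hv, hv0⟩ := Module.End.HasEigenvalue.exists_hasEigenvector hμ
  have h1 := toEuclideanLin_minimalIdempotent (G := G) μ v
  rw [h, map_zero, LinearMap.zero_apply,
    Submodule.starProjection_eq_self_iff.2 (show v ∈ eigenspace G μ from hv)] at h1
  exact hv0 h1.symm

theorem mem_eigenvalues_of_mul_eq_smul {μ : ℝ} {M : Matrix V V ℝ}
    (hM : G.adjMatrix ℝ * M = μ • M) (h0 : M ≠ 0) : μ ∈ eigenvalues G := by
  have h1 : Matrix.toEuclideanLin M ≠ 0 := by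
    rwa [Ne, LinearEquiv.map_eq_zero_iff]
  obtain ⟨v, hv⟩ : ∃ v, Matrix.toEuclideanLin M v ≠ 0 := by
    by_contra! h
    exact h1 (LinearMap.ext h)
  refine Module.End.hasEigenvalue_of_hasEigenvector
    (x := Matrix.toEuclideanLin M v) ⟨Module.End.mem_eigenspace_iff.2 ?_, hv⟩
  rw [← LinearMap.comp_apply, ← Matrix.toLpLin_mul_same, hM, map_smul, LinearMap.smul_apply]

/-- A minimal idempotent is a polynomial in the adjacency matrix: the eigenspaces span the whole
space, and on each of them the Lagrange polynomial of `μ` acts as the projection. -/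
theorem exists_aeval_adjMatrix_eq_minimalIdempotent (μ : ℝ) :
    ∃ p : Polynomial ℝ, Polynomial.aeval (G.adjMatrix ℝ) p = minimalIdempotent G μ := by
  set T := Matrix.toEuclideanLin (G.adjMatrix ℝ) with hT
  have hsymm : T.IsSymmetric := Matrix.isSymmetric_toEuclideanLin_iff.2
    (by simp)
  have hfin : {ν | Module.End.HasEigenvalue T ν}.Finite := Module.End.finite_hasEigenvalue T
  set p : Polynomial ℝ := ∏ ν ∈ hfin.toFinset.erase μ,
    (Polynomial.C ((μ - ν)⁻¹) * (Polynomial.X - Polynomial.C ν)) with hp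
  refine ⟨p, Matrix.toEuclideanLin.injective ?_⟩
  have h1 : Matrix.toEuclideanLin (Polynomial.aeval (G.adjMatrix ℝ) p) = Polynomial.aeval T p :=
    (Polynomial.aeval_algHom_apply (Matrix.toLpLinAlgEquiv (R := ℝ) (n := V) 2).toAlgHom
      (G.adjMatrix ℝ) p).symm
  have hsup : ⨆ ν, Module.End.eigenspace T ν = ⊤ :=
    Submodule.orthogonal_eq_bot_iff.1 hsymm.orthogonalComplement_iSup_eigenspaces_eq_bot
  have hle : ⨆ ν, Module.End.eigenspace T ν ≤
      LinearMap.eqLocus (Polynomial.aeval T p)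
        (Matrix.toEuclideanLin (minimalIdempotent G μ)) := by
    refine iSup_le fun ν v hv => ?_
    rw [LinearMap.mem_eqLocus, toEuclideanLin_minimalIdempotent]
    by_cases hv0 : v = 0
    · simp [hv0]
    have hvec : Module.End.HasEigenvector T ν v := ⟨hv, hv0⟩
    rw [Module.End.aeval_apply_of_hasEigenvector hvec]
    by_cases hνμ : ν = μ
    · subst hνμ
      have : p.eval ν = 1 := by
        rw [hp, Polynomial.eval_prod]
        refine prod_eq_one fun η hη => ?_
        have : ν - η ≠ 0 := sub_ne_zero.2 (ne_of_mem_erase hη).symm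
        simp [this]
      rw [this, one_smul, Submodule.starProjection_eq_self_iff.2 (show v ∈ eigenspace G ν from hv)]
    · have : p.eval ν = 0 := by
        rw [hp, Polynomial.eval_prod]
        refine prod_eq_zero (i := ν) (mem_erase.2 ⟨hνμ, ?_⟩) (by simp)
        simpa using Module.End.hasEigenvalue_of_hasEigenvector hvec
      rw [this, zero_smul]
      symm
      rw [Submodule.starProjection_apply_eq_zero_iff, Submodule.mem_orthogonal]
      intro u hu
      exact hsymm.orthogonalFamily_eigenspaces.pairwise hνμ hv u hu
  rw [hsup] at hle
  rw [h1]
  exact LinearMap.ext fun v => hle (Submodule.mem_top (x := v))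

namespace IsDistanceRegular

variable {D : ℕ} {b c : ℕ → ℕ}

theorem exists_aeval_adjMatrix_apply (hG : IsDistanceRegular G D b c) (p : Polynomial ℝ) :
    ∃ f : ℕ → ℝ, ∀ x y, Polynomial.aeval (G.adjMatrix ℝ) p x y = f (G.dist x y) := by
  induction p using Polynomial.induction_on with
  | C r =>
    refine ⟨fun i => if i = 0 then r else 0, fun x y => ?_⟩
    simp [Matrix.algebraMap_matrix_apply, hG.connected.dist_eq_zero_iff]
  | add p q hp hq =>
    obtain ⟨f, hf⟩ := hp
    obtain ⟨g, hg⟩ := hq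
    exact ⟨fun i => f i + g i, fun x y => by simp [hf, hg]⟩
  | monomial n r h =>
    obtain ⟨f, hf⟩ := h
    refine ⟨fun i => c i * f (i - 1) + ((b 0 : ℝ) - b i - c i) * f i + b i * f (i + 1),
      fun x y => ?_⟩
    rw [pow_succ', ← mul_assoc, mul_comm (Polynomial.C r), mul_assoc, map_mul, Polynomial.aeval_X]
    exact hG.adjMatrix_mul_apply hf x y

/-- The entries of a minimal idempotent depend only on the distance. -/
theorem exists_minimalIdempotent_apply (hG : IsDistanceRegular G D b c) (μ : ℝ) :
    ∃ f : ℕ → ℝ, IsEigenseq D b c μ f ∧ ∀ x y, minimalIdempotent G μ x y = f (G.dist x y) := by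
  obtain ⟨p, hp⟩ := exists_aeval_adjMatrix_eq_minimalIdempotent (G := G) μ
  obtain ⟨f, hf⟩ := hG.exists_aeval_adjMatrix_apply p
  rw [hp] at hf
  exact ⟨f, hG.isEigenseq_of_mul_eq_smul hf (adjMatrix_mul_minimalIdempotent μ), hf⟩

theorem valency_mem_eigenvalues (hG : IsDistanceRegular G D b c) : (b 0 : ℝ) ∈ eigenvalues G := by
  obtain ⟨x⟩ := hG.connected.nonempty
  refine mem_eigenvalues_of_mul_eq_smul (M := Matrix.of fun _ _ => 1)
    (hG.mul_eq_smul_of_isEigenseq (f := fun _ => 1) (by simp) fun i _ => by ring) fun h => ?_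
  simpa using congrFun₂ h x x

end IsDistanceRegular

end Idempotent

/-! ### The Gram matrix of the smallest eigenvalue -/

section Gram

variable {V : Type*} {G : SimpleGraph V}

theorem mulVec_eq_zero_of_dotProduct_nonpos [Fintype V] {X : Matrix V V ℝ}
    (hX : X.PosSemidef) {v : V → ℝ} (h : v ⬝ᵥ X *ᵥ v ≤ 0) : X *ᵥ v = 0 := by
  classical
  have h1 : 0 ≤ v ⬝ᵥ X *ᵥ v := by simpa using hX.dotProduct_mulVec_nonneg v
  exact (hX.dotProduct_mulVec_zero_iff v).1 (by simpa using le_antisymm h h1)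

/-- `X` is a positive semidefinite matrix whose entries `ω (dist x y)`, normalised by `ω 0 = 1`,
form an eigenvector for the eigenvalue `-k / s` in each column, where `s = a 1 + 1`, in a
distance-regular graph with `c 2 = s ^ 2 + 1`. Thus `X` is the Gram matrix of unit vectors `x̂`
indexed by the vertices. -/
structure IsTailGram (G : SimpleGraph V) (D : ℕ) (b c : ℕ → ℕ) (s : ℕ) (ω : ℕ → ℝ)
    (X : Matrix V V ℝ) : Prop where
  distReg : IsDistanceRegular G D b c
  two_le_diam : 2 ≤ D
  one_lt : 1 < s
  interA_one : interA b c 1 + 1 = s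
  c_two : c 2 = s ^ 2 + 1
  posSemidef : X.PosSemidef
  apply_eq : ∀ x y, X x y = ω (G.dist x y)
  omega_zero : ω 0 = 1
  eigenseq : IsEigenseq D b c (-(b 0 : ℝ) / s) ω

namespace IsTailGram

variable {D : ℕ} {b c : ℕ → ℕ} {s : ℕ} {ω : ℕ → ℝ} {X : Matrix V V ℝ}

theorem cast_pos (h : IsTailGram G D b c s ω X) : (0 : ℝ) < s := by
  exact_mod_cast (zero_lt_one.trans h.one_lt)

theorem one_lt_cast (h : IsTailGram G D b c s ω X) : (1 : ℝ) < s := by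
  exact_mod_cast h.one_lt

theorem apply_self (h : IsTailGram G D b c s ω X) (x : V) : X x x = 1 := by
  rw [h.apply_eq, G.dist_self, h.omega_zero]

theorem apply_comm (h : IsTailGram G D b c s ω X) (x y : V) : X x y = X y x := by
  rw [h.apply_eq, h.apply_eq, G.dist_comm]

theorem dist_eq_two (h : IsTailGram G D b c s ω X) {x y z : V} (hy : G.Adj x y) (hz : G.Adj x z)
    (hyz : y ≠ z) (hadj : ¬ G.Adj y z) : G.dist y z = 2 := by
  have h1 := dist_le_of_adj h.distReg.connected y hz
  rw [SimpleGraph.dist_eq_one_iff_adj.2 hy.symm] at h1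
  have h2 := h.distReg.connected.one_lt_dist_of_ne_of_not_adj hyz hadj
  omega

theorem lt_valency (h : IsTailGram G D b c s ω X) :
    ((b 0 : ℝ) - s * (s + 1)) / s ^ 2 < b 0 := by
  have hs := h.one_lt_cast
  rw [div_lt_iff₀ (by positivity)]
  have h1 : (b 0 : ℝ) * 1 ≤ b 0 * s ^ 2 :=
    mul_le_mul_of_nonneg_left (one_le_pow₀ hs.le) (Nat.cast_nonneg _)
  have h2 : 0 < (s : ℝ) * (s + 1) := by positivity
  linarith

variable [Fintype V]

theorem valency_pos (h : IsTailGram G D b c s ω X) : (0 : ℝ) < b 0 := by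
  exact_mod_cast h.distReg.b_pos (zero_lt_two.trans_le h.two_le_diam)

theorem denom_pos (h : IsTailGram G D b c s ω X) : (0 : ℝ) < b 0 * (s - 1) + s :=
  add_pos (mul_pos h.valency_pos (sub_pos.2 h.one_lt_cast)) h.cast_pos

theorem b_one (h : IsTailGram G D b c s ω X) : (b 1 : ℝ) = b 0 - s := by
  obtain ⟨x, y, hxy⟩ := h.distReg.exists_dist_eq (one_le_two.trans h.two_le_diam)
  have h1 := interA_spec h.distReg x y
  rw [hxy, h.distReg.c_one (one_le_two.trans h.two_le_diam)] at h1
  have h2 := h.interA_one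
  rw [eq_sub_iff_add_eq]
  exact_mod_cast (by omega : b 1 + s = b 0)

theorem omega_one (h : IsTailGram G D b c s ω X) : ω 1 = -1 / s := by
  have h1 := h.eigenseq 0 (Nat.zero_le _)
  have h2 : (b 0 : ℝ) ≠ 0 := by
    exact_mod_cast (h.distReg.b_pos (zero_lt_two.trans_le h.two_le_diam)).ne'
  rw [h.distReg.c_zero, h.omega_zero] at h1
  refine mul_left_cancel₀ h2 ?_
  simp only [Nat.cast_zero, zero_add] at h1
  linear_combination h1

theorem omega_two (h : IsTailGram G D b c s ω X) : ω 2 = 1 / s ^ 2 := by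
  have hs := h.cast_pos
  have h1 := h.eigenseq 1 (one_le_two.trans h.two_le_diam)
  have h2 : (b 1 : ℝ) ≠ 0 := by
    exact_mod_cast (h.distReg.b_pos (one_lt_two.trans_le h.two_le_diam)).ne'
  rw [h.distReg.c_one (one_le_two.trans h.two_le_diam), Nat.sub_self, h.omega_zero,
    h.omega_one] at h1
  refine mul_left_cancel₀ h2 ?_
  rw [h.b_one] at h1 ⊢
  simp only [Nat.cast_one, Nat.reduceAdd] at h1
  have h3 : ((b 0 : ℝ) - s) * ω 2 =
      -(b 0 : ℝ) / s * (-1 / s) - 1 - (b 0 - (b 0 - s) - 1) * (-1 / s) := by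
    linear_combination h1
  rw [h3]
  field_simp
  ring

theorem apply_adj (h : IsTailGram G D b c s ω X) {x y : V} (hxy : G.Adj x y) :
    X x y = -1 / s := by
  rw [h.apply_eq, SimpleGraph.dist_eq_one_iff_adj.2 hxy, h.omega_one]

theorem apply_dist_two (h : IsTailGram G D b c s ω X) {x y : V} (hxy : G.dist x y = 2) :
    X x y = 1 / s ^ 2 := by
  rw [h.apply_eq, hxy, h.omega_two]

theorem omega_sq_sub_pos (h : IsTailGram G D b c s ω X) :
    0 < ω 0 ^ 2 - s / (b 0 * (s - 1) + s : ℝ) := by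
  rw [h.omega_zero, one_pow, sub_pos, div_lt_one h.denom_pos]
  exact lt_add_of_pos_left _ (mul_pos h.valency_pos (sub_pos.2 h.one_lt_cast))

variable [DecidableEq V] [DecidableRel G.Adj]

/-- At distance two, `s (x̂ + ŷ) + ∑ ẑ` (over the common neighbours `z`) has norm at most `0`, with
equality only if no two common neighbours are adjacent. -/
theorem relation_of_dist_eq_two (h : IsTailGram G D b c s ω X) {x y : V} (hxy : G.dist x y = 2) :
    (∀ u, (s : ℝ) * (X x u + X y u) + ∑ z ∈ G.neighborFinset x ∩ G.neighborFinset y, X z u = 0) ∧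
      ∀ z ∈ G.neighborFinset x ∩ G.neighborFinset y,
        ∀ w ∈ G.neighborFinset x ∩ G.neighborFinset y, ¬ G.Adj z w := by
  have hs := h.cast_pos
  set S := G.neighborFinset x ∩ G.neighborFinset y with hS
  have hcard : (#S : ℝ) = s ^ 2 + 1 := by
    rw [hS, h.distReg.card_commonNeighbors_of_dist_eq_two hxy, h.c_two]
    push_cast
    rfl
  -- the coefficients of the combination `s (x̂ + ŷ) + ∑ ẑ`
  set v : V → ℝ := fun w => s * ((if w = x then 1 else 0) + if w = y then 1 else 0) +
    if w ∈ S then 1 else 0 with hv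
  have hdot : ∀ g : V → ℝ, v ⬝ᵥ g = s * (g x + g y) + ∑ z ∈ S, g z := by
    intro g
    simp [hv, dotProduct, add_mul, mul_assoc, sum_add_distrib, ← mul_sum]
  have hmul : ∀ u, (X *ᵥ v) u = s * (X x u + X y u) + ∑ z ∈ S, X z u := by
    intro u
    rw [Matrix.mulVec, dotProduct_comm, hdot]
    simp only [h.apply_comm u]
  have hmem : ∀ z ∈ S, G.Adj x z ∧ G.Adj y z := by
    intro z hz
    simpa [hS] using hz
  have hx : (X *ᵥ v) x = 0 := by
    rw [hmul, h.apply_self, h.apply_comm, h.apply_dist_two hxy,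
      sum_congr rfl fun z hz => h.apply_adj (hmem z hz).1.symm, sum_const, nsmul_eq_mul, hcard]
    field_simp
    ring
  have hy : (X *ᵥ v) y = 0 := by
    rw [hmul, h.apply_self, h.apply_dist_two hxy,
      sum_congr rfl fun z hz => h.apply_adj (hmem z hz).2.symm, sum_const, nsmul_eq_mul, hcard]
    field_simp
    ring
  -- the inner products with `x̂`, `ŷ` vanish, so the norm is the sum of those with the `ẑ`
  have hval : ∀ z ∈ S, ∀ w ∈ S.erase z, X w z ≤ 1 / s ^ 2 := by
    intro z hz w hw
    rw [mem_erase] at hw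
    by_cases hadj : G.Adj w z
    · rw [h.apply_adj hadj]
      have h1 : -1 / (s : ℝ) ≤ 0 := by
        rw [neg_div]
        exact neg_nonpos.2 (by positivity)
      exact h1.trans (by positivity)
    · exact (h.apply_dist_two (h.dist_eq_two (hmem w hw.2).1 (hmem z hz).1 hw.1 hadj)).le
  have hconst : ∀ z ∈ S, ∑ w ∈ S.erase z, 1 / (s : ℝ) ^ 2 = 1 := by
    intro z hz
    rw [sum_const, nsmul_eq_mul, card_erase_of_mem hz,
      Nat.cast_sub (card_pos.2 ⟨z, hz⟩), hcard]
    field_simp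
    simp
  have hz : ∀ z ∈ S, (X *ᵥ v) z = ∑ w ∈ S.erase z, X w z - 1 := by
    intro z hz
    rw [hmul, ← add_sum_erase S _ hz, h.apply_self, h.apply_adj (hmem z hz).1,
      h.apply_adj (hmem z hz).2]
    field_simp
    ring
  have hz0 : ∀ z ∈ S, (X *ᵥ v) z ≤ 0 := by
    intro z hzS
    have h1 := sum_le_sum (hval z hzS)
    rw [hconst z hzS] at h1
    rw [hz z hzS]
    linarith
  have hzero : X *ᵥ v = 0 := by
    refine mulVec_eq_zero_of_dotProduct_nonpos h.posSemidef ?_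
    rw [hdot, hx, hy, add_zero, mul_zero, zero_add]
    exact sum_nonpos hz0
  refine ⟨fun u => by rw [← hmul, hzero, Pi.zero_apply], fun z hzS w hwS hadj => ?_⟩
  have h1 : ∑ u ∈ S.erase z, X u z < ∑ u ∈ S.erase z, 1 / (s : ℝ) ^ 2 := by
    refine sum_lt_sum (hval z hzS) ⟨w, mem_erase.2 ⟨hadj.ne', hwS⟩, ?_⟩
    rw [h.apply_adj hadj.symm, neg_div]
    exact (neg_neg_of_pos (by positivity)).trans (by positivity)
  rw [hconst z hzS] at h1
  have h2 := hz z hzS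
  rw [hzero, Pi.zero_apply] at h2
  linarith

/-- The vectors of an edge and of its common neighbours sum to zero: these vertices form a clique of
size `s + 1`, since two non-adjacent common neighbours would themselves have two adjacent common
neighbours. -/
theorem relation_of_adj (h : IsTailGram G D b c s ω X) {x y : V} (hxy : G.Adj x y) (u : V) :
    X x u + X y u + ∑ z ∈ G.neighborFinset x ∩ G.neighborFinset y, X z u = 0 := by
  have hs := h.cast_pos
  set S := G.neighborFinset x ∩ G.neighborFinset y with hS
  have hmem : ∀ z ∈ S, G.Adj x z ∧ G.Adj y z := by
    intro z hz
    simpa [hS] using hz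
  have hcard : #S + 1 = s := by
    rw [hS, h.distReg.card_commonNeighbors_of_adj hxy, h.interA_one]
  have hclique : ∀ z ∈ S, ∀ w ∈ S, z ≠ w → G.Adj z w := by
    intro z hz w hw hzw
    by_contra hadj
    refine (h.relation_of_dist_eq_two (h.dist_eq_two (hmem z hz).1 (hmem w hw).1 hzw hadj)).2
      x ?_ y ?_ hxy
    · simp [(hmem z hz).1.symm, (hmem w hw).1.symm]
    · simp [(hmem z hz).2.symm, (hmem w hw).2.symm]
  have hyS : y ∉ S := fun hy => G.loopless.irrefl y (hmem y hy).2
  have hxS : x ∉ insert y S := by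
    rw [mem_insert]
    rintro (hx | hx)
    · exact hxy.ne hx
    · exact G.loopless.irrefl x (hmem x hx).1
  set C := insert x (insert y S) with hC
  have hcardC : #C = s + 1 := by
    rw [hC, card_insert_of_notMem hxS, card_insert_of_notMem hyS, hcard]
  have hadj : ∀ z ∈ C, ∀ w ∈ C, z ≠ w → G.Adj z w := by
    intro z hz w hw hzw
    rw [hC, mem_insert, mem_insert] at hz hw
    rcases hz with rfl | rfl | hz <;> rcases hw with rfl | rfl | hw
    · exact absurd rfl hzw
    · exact hxy
    · exact (hmem w hw).1
    · exact hxy.symm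
    · exact absurd rfl hzw
    · exact (hmem w hw).2
    · exact (hmem z hz).1.symm
    · exact (hmem z hz).2.symm
    · exact hclique z hz w hw hzw
  set v : V → ℝ := fun w => if w ∈ C then 1 else 0 with hv
  have hdot : ∀ g : V → ℝ, v ⬝ᵥ g = ∑ z ∈ C, g z := by
    intro g
    simp [hv, dotProduct]
  have hmul : ∀ u, (X *ᵥ v) u = ∑ z ∈ C, X z u := by
    intro u
    rw [Matrix.mulVec, dotProduct_comm, hdot]
    simp only [h.apply_comm u]
  have hzero : X *ᵥ v = 0 := by
    refine mulVec_eq_zero_of_dotProduct_nonpos h.posSemidef ?_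
    rw [hdot]
    refine (sum_eq_zero fun z hz => ?_).le
    rw [hmul, ← add_sum_erase C _ hz, h.apply_self,
      sum_congr rfl fun w hw =>
        h.apply_adj (hadj w (mem_of_mem_erase hw) z hz (ne_of_mem_erase hw)),
      sum_const, card_erase_of_mem hz, hcardC, nsmul_eq_mul, Nat.add_sub_cancel]
    field_simp
    ring
  have h1 := hmul u
  rw [hzero, Pi.zero_apply, hC, sum_insert hxS, sum_insert hyS, ← add_assoc] at h1
  exact h1.symm

/-- The relation of a pair `x`, `y` at distance two, tested against a vertex at distances `i` and
`i + 2` from `x` and `y`: all common neighbours are at distance `i + 1` from it. -/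
theorem omega_add_two (h : IsTailGram G D b c s ω X) {i : ℕ} (hi : i + 2 ≤ D) :
    (s : ℝ) * (ω i + ω (i + 2)) + (s ^ 2 + 1) * ω (i + 1) = 0 := by
  obtain ⟨v, y, hvy⟩ := h.distReg.exists_dist_eq hi
  obtain ⟨z, hyz, hvz⟩ := exists_adj_dist_eq h.distReg.connected hvy
  obtain ⟨x, hzx, hvx⟩ := exists_adj_dist_eq h.distReg.connected hvz
  have hxy : G.dist x y = 2 := by
    have h1 := dist_le_of_adj h.distReg.connected x hyz.symm
    rw [SimpleGraph.dist_eq_one_iff_adj.2 hzx.symm] at h1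
    have h2 := h.distReg.connected.dist_triangle (u := v) (v := x) (w := y)
    omega
  have h1 := (h.relation_of_dist_eq_two hxy).1 v
  have h2 : ∀ w ∈ G.neighborFinset x ∩ G.neighborFinset y, X w v = ω (i + 1) := by
    intro w hw
    rw [mem_inter, SimpleGraph.mem_neighborFinset, SimpleGraph.mem_neighborFinset] at hw
    have h3 := dist_le_of_adj h.distReg.connected v hw.1
    have h4 := dist_le_of_adj h.distReg.connected v hw.2.symm
    rw [h.apply_eq, G.dist_comm]
    congr 1
    omega
  rw [sum_congr rfl h2, sum_const, nsmul_eq_mul,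
    h.distReg.card_commonNeighbors_of_dist_eq_two hxy, h.c_two, h.apply_eq, h.apply_eq,
    G.dist_comm, hvx, G.dist_comm, hvy] at h1
  exact_mod_cast h1

theorem omega_eq (h : IsTailGram G D b c s ω X) {i : ℕ} (hi : i ≤ D) :
    ω i = (-1 / (s : ℝ)) ^ i := by
  have hs := h.cast_pos
  induction i using Nat.twoStepInduction with
  | zero => rw [h.omega_zero, pow_zero]
  | one => rw [h.omega_one, pow_one]
  | more i h1 h2 =>
    have h3 := h.omega_add_two hi
    rw [h1 (by omega), h2 (by omega)] at h3
    refine mul_left_cancel₀ hs.ne' ?_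
    have h4 : (s : ℝ) * (-1 / s) = -1 := by field_simp
    rw [pow_succ (-1 / (s : ℝ)) i] at h3
    rw [pow_succ, pow_succ]
    linear_combination h3 - (-1 / (s : ℝ)) ^ i * (s + -1 / s) * h4

/-- The vectors of the closed neighbourhood of `v` form a weighted tight frame, in which the weight
of `v̂` itself may be negative: `∑ ẑ ẑᵀ + γ v̂ v̂ᵀ` is a multiple of the identity. This holds on
the neighbourhood by the relations of the cliques through `v`, and it extends to all `x̂`,
because for `x` at distance at least two from `v` the relation of pairs at distance two writes `x̂`
as a linear combination of vectors of vertices closer to `v`. -/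
theorem sum_neighborFinset_mul (h : IsTailGram G D b c s ω X) (v x u : V) :
    ∑ z ∈ G.neighborFinset v, X x z * X z u + ((s + 1) / s - b 0 / s ^ 2) * (X x v * X v u) =
      (s + 1) / s * X x u := by
  have hs := h.cast_pos
  have hsum : ∀ v : V, ∑ z ∈ G.neighborFinset v, X z u = -(b 0 : ℝ) / s * X v u := by
    intro v
    rw [← SimpleGraph.adjMatrix_mul_apply,
      h.distReg.mul_eq_smul_of_isEigenseq h.apply_eq h.eigenseq, Matrix.smul_apply, smul_eq_mul]
  induction hn : G.dist v x using Nat.strong_induction_on generalizing x with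
  | _ n ih =>
    rcases n with _ | _ | n
    · obtain rfl := h.distReg.connected.dist_eq_zero_iff.1 hn
      have h1 : ∀ z ∈ G.neighborFinset v, X v z * X z u = -1 / s * X z u := by
        intro z hz
        rw [h.apply_adj ((SimpleGraph.mem_neighborFinset _ _ _).1 hz)]
      rw [sum_congr rfl h1, ← mul_sum, hsum, h.apply_self]
      field_simp
      ring
    · have hadj : G.Adj v x := SimpleGraph.dist_eq_one_iff_adj.1 hn
      have h1 : ∀ z ∈ G.neighborFinset v, X x z * X z u = 1 / s ^ 2 * X z u +
          ((if z = x then (1 - 1 / s ^ 2) * X x u else 0) +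
            if z ∈ G.neighborFinset x then (-1 / s - 1 / s ^ 2) * X z u else 0) := by
        intro z hz
        rw [SimpleGraph.mem_neighborFinset] at hz
        by_cases hzx : z = x
        · subst hzx
          rw [if_pos rfl, if_neg (by simp), h.apply_self]
          ring
        · by_cases hz2 : G.Adj x z
          · rw [if_neg hzx, if_pos (by simpa using hz2), h.apply_adj hz2]
            ring
          · rw [if_neg hzx, if_neg (by simpa using hz2),
              h.apply_dist_two (h.dist_eq_two hadj hz (Ne.symm hzx) hz2)]
            ring
      rw [sum_congr rfl h1, sum_add_distrib, sum_add_distrib, ← mul_sum, hsum,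
        sum_ite_eq_of_mem' _ _ _ ((SimpleGraph.mem_neighborFinset _ _ _).2 hadj), ← sum_filter,
        filter_mem_eq_inter, ← mul_sum, h.apply_adj hadj.symm]
      have h2 := h.relation_of_adj hadj u
      have h3 : ∑ z ∈ G.neighborFinset v ∩ G.neighborFinset x, X z u = -(X v u + X x u) := by
        linarith
      rw [h3]
      field_simp
      ring
    · obtain ⟨z, hxz, hvz⟩ := exists_adj_dist_eq h.distReg.connected hn
      obtain ⟨w, hzw, hvw⟩ := exists_adj_dist_eq h.distReg.connected hvz
      have hwx : G.dist w x = 2 := by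
        have h1 := dist_le_of_adj h.distReg.connected w hxz.symm
        rw [SimpleGraph.dist_eq_one_iff_adj.2 hzw.symm] at h1
        have h2 := h.distReg.connected.dist_triangle (u := v) (v := w) (w := x)
        omega
      -- `x̂` is a combination of `ŵ` and of the common neighbours of `w` and `x`
      have hrel : ∀ a, X x a =
          -X w a - 1 / s * ∑ y ∈ G.neighborFinset w ∩ G.neighborFinset x, X y a := by
        intro a
        have h1 := (h.relation_of_dist_eq_two hwx).1 a
        field_simp
        linarith
      have ihw := ih n (by omega) w hvw
      have ihy : ∀ y ∈ G.neighborFinset w ∩ G.neighborFinset x, _ := fun y hy =>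
        ih (n + 1) (by omega) y (by
          rw [mem_inter, SimpleGraph.mem_neighborFinset, SimpleGraph.mem_neighborFinset] at hy
          have h3 := dist_le_of_adj h.distReg.connected v hy.1
          have h4 := dist_le_of_adj h.distReg.connected v hy.2.symm
          omega)
      have hy := sum_congr rfl ihy
      rw [sum_add_distrib, sum_comm, ← mul_sum, ← mul_sum, ← sum_mul] at hy
      simp only [← sum_mul] at hy
      have e1 : ∑ a ∈ G.neighborFinset v, X x a * X a u =
          -∑ a ∈ G.neighborFinset v, X w a * X a u - 1 / s * ∑ a ∈ G.neighborFinset v,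
            (∑ y ∈ G.neighborFinset w ∩ G.neighborFinset x, X y a) * X a u := by
        rw [mul_sum, ← sum_neg_distrib, ← sum_sub_distrib]
        refine sum_congr rfl fun a _ => ?_
        rw [hrel a]
        ring
      rw [e1, hrel v, hrel u]
      linear_combination -ihw - 1 / s * hy

/-- The frame identity with `x = u`: the entrywise square of `X` satisfies an affine three-term
recurrence. -/
theorem omega_sq (h : IsTailGram G D b c s ω X) {i : ℕ} (hi : i ≤ D) :
    (c i : ℝ) * ω (i - 1) ^ 2 + ((b 0 : ℝ) - b i - c i) * ω i ^ 2 + (b i : ℝ) * ω (i + 1) ^ 2 =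
      (b 0 - s * (s + 1)) / s ^ 2 * ω i ^ 2 + (s + 1) / s := by
  have hs := h.cast_pos
  obtain ⟨x, v, rfl⟩ := h.distReg.exists_dist_eq hi
  have h1 := h.sum_neighborFinset_mul v x x
  simp only [h.apply_comm _ x] at h1
  rw [h.apply_self] at h1
  simp only [h.apply_eq, ← sq] at h1
  rw [← h.distReg.sum_neighborFinset (fun i => ω i ^ 2), eq_sub_of_add_eq h1]
  field_simp
  ring

end IsTailGram

end Gram

/-! ### The second largest eigenvalue and the light tail -/

section Tail

variable {V : Type*} [Fintype V] [DecidableEq V] {G : SimpleGraph V} [DecidableRel G.Adj]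
  {D : ℕ} {b c : ℕ → ℕ}

theorem IsDistanceRegular.exists_minimalIdempotent_apply_pos (hG : IsDistanceRegular G D b c)
    {μ : ℝ} (hμ : μ ∈ eigenvalues G) :
    ∃ f : ℕ → ℝ, IsEigenseq D b c μ f ∧ (∀ x y, minimalIdempotent G μ x y = f (G.dist x y)) ∧
      0 < f 0 := by
  obtain ⟨f, hf, hf'⟩ := hG.exists_minimalIdempotent_apply μ
  refine ⟨f, hf, hf', lt_of_le_of_ne ?_ fun h0 => minimalIdempotent_ne_zero hμ ?_⟩
  · obtain ⟨x⟩ := hG.connected.nonempty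
    have h1 := (minimalIdempotent_posSemidef (G := G) μ).diag_nonneg (i := x)
    rwa [hf', G.dist_self] at h1
  · ext x y
    rw [hf', hG.eq_zero_of_isEigenseq hf h0.symm _ (hG.dist_le x y), Matrix.zero_apply]

namespace IsTailGram

variable {s : ℕ} {ω : ℕ → ℝ} {X : Matrix V V ℝ}

/-- Without its component along the constants, `ω ^ 2` belongs to a single eigenvalue. -/
theorem isEigenseq_omega_sq_sub (h : IsTailGram G D b c s ω X) :
    IsEigenseq D b c (((b 0 : ℝ) - s * (s + 1)) / s ^ 2)
      (fun i => ω i ^ 2 - s / (b 0 * (s - 1) + s)) := by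
  intro i hi
  have hs := h.cast_pos
  have hd := h.denom_pos
  -- the constant is `((s + 1) / s) / (k - τ)`, where `τ` is the eigenvalue
  have h1 : (s : ℝ) / (b 0 * (s - 1) + s) * (b 0 - ((b 0 : ℝ) - s * (s + 1)) / s ^ 2) =
      (s + 1) / s := by
    field_simp
    ring
  linear_combination h.omega_sq hi - h1

theorem omega_sq_succ_lt (h : IsTailGram G D b c s ω X) {i : ℕ} (hi : i < D) :
    ω (i + 1) ^ 2 < ω i ^ 2 := by
  have hs := h.one_lt_cast
  rw [h.omega_eq hi, h.omega_eq hi.le, ← pow_mul, ← pow_mul, mul_comm, mul_comm i, pow_mul,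
    pow_mul, neg_div, neg_sq]
  refine pow_lt_pow_right_of_lt_one₀ (by positivity) ?_ (Nat.lt_succ_self i)
  rw [div_pow, one_pow, div_lt_one (by positivity)]
  exact one_lt_pow₀ hs two_ne_zero

theorem mem_eigenvalues (h : IsTailGram G D b c s ω X) :
    ((b 0 : ℝ) - s * (s + 1)) / s ^ 2 ∈ eigenvalues G := by
  obtain ⟨x⟩ := h.distReg.connected.nonempty
  refine mem_eigenvalues_of_mul_eq_smul
    (M := Matrix.of fun x y => ω (G.dist x y) ^ 2 - s / (b 0 * (s - 1) + s))
    (h.distReg.mul_eq_smul_of_isEigenseq (fun _ _ => rfl) h.isEigenseq_omega_sq_sub) fun h0 => ?_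
  have h1 := congrFun₂ h0 x x
  rw [Matrix.of_apply, G.dist_self] at h1
  exact h.omega_sq_sub_pos.ne' h1

theorem le_of_mem_eigenvalues (h : IsTailGram G D b c s ω X) {μ : ℝ} (hμ : μ ∈ eigenvalues G)
    (hne : μ ≠ b 0) : μ ≤ ((b 0 : ℝ) - s * (s + 1)) / s ^ 2 := by
  obtain ⟨f, hf, -, hf0⟩ := h.distReg.exists_minimalIdempotent_apply_pos hμ
  refine h.distReg.le_of_isEigenseq_of_strictAnti hf h.isEigenseq_omega_sq_sub
    (fun i hi => sub_lt_sub_right (h.omega_sq_succ_lt hi) _)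
    ⟨0, zero_lt_two.trans_le h.two_le_diam, fun h01 => hne ?_⟩
  exact h.distReg.eq_valency_of_isEigenseq hf hf0.ne' h01

/-- Every eigenvalue other than the valency is at most `τ`, and `τ` is an eigenvalue. -/
theorem second_eigenvalue_eq (h : IsTailGram G D b c s ω X) {θ : ℕ → ℝ}
    (hθ : StrictAntiOn θ (Set.Iic D)) (hθG : θ '' Set.Iic D = eigenvalues G) :
    θ 1 = ((b 0 : ℝ) - s * (s + 1)) / s ^ 2 := by
  have hD := h.two_le_diam
  have hmem : ∀ i ≤ D, θ i ∈ eigenvalues G := fun i hi => hθG ▸ ⟨i, hi, rfl⟩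
  have hlt := h.lt_valency
  have h0 : θ 0 = b 0 := by
    by_contra h0
    obtain ⟨j, hj, hjk⟩ : (b 0 : ℝ) ∈ θ '' Set.Iic D := hθG ▸ h.distReg.valency_mem_eigenvalues
    have h1 := h.le_of_mem_eigenvalues (hmem 0 (Nat.zero_le _)) h0
    have h2 := hθ.antitoneOn (Set.mem_Iic.2 (Nat.zero_le D)) hj (Nat.zero_le j)
    linarith
  have h10 : θ 1 < θ 0 :=
    hθ (Set.mem_Iic.2 (Nat.zero_le D)) (Set.mem_Iic.2 (by omega)) zero_lt_one
  refine le_antisymm (h.le_of_mem_eigenvalues (hmem 1 (by omega)) (h0 ▸ h10.ne)) ?_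
  obtain ⟨j, hj, hjτ⟩ :
      ((b 0 : ℝ) - s * (s + 1)) / s ^ 2 ∈ θ '' Set.Iic D := hθG ▸ h.mem_eigenvalues
  have hj1 : 1 ≤ j := by
    rw [Nat.one_le_iff_ne_zero]
    rintro rfl
    linarith
  rw [← hjτ]
  exact hθ.antitoneOn (Set.mem_Iic.2 (by omega)) hj hj1

theorem isLightTailWith (h : IsTailGram G D b c s ω X) {μ e : ℝ} (hμ : μ ∈ eigenvalues G)
    (he : e ≠ 0) (hE : ∀ x y, minimalIdempotent G μ x y = e * ω (G.dist x y)) :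
    IsLightTailWith G (minimalIdempotent G μ)
      (minimalIdempotent G (((b 0 : ℝ) - s * (s + 1)) / s ^ 2)) := by
  set τ := ((b 0 : ℝ) - s * (s + 1)) / s ^ 2 with hτ
  obtain ⟨f, hf, hF, hf0⟩ := h.distReg.exists_minimalIdempotent_apply_pos h.mem_eigenvalues
  have hn : (Fintype.card V : ℝ) ≠ 0 := by
    have := h.distReg.connected.nonempty
    exact_mod_cast Fintype.card_ne_zero
  refine ⟨⟨μ, hμ, rfl⟩, ⟨τ, h.mem_eigenvalues, rfl⟩, fun h0 => ?_,
    e ^ 2 * (s / (b 0 * (s - 1) + s)) * Fintype.card V,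
    e ^ 2 * ((ω 0 ^ 2 - s / (b 0 * (s - 1) + s)) / f 0), ?_, ?_, ?_⟩
  · -- `E₀` is constant, so that it belongs to the valency
    refine h.lt_valency.ne (h.distReg.eq_valency_of_isEigenseq hf hf0.ne' ?_)
    obtain ⟨x, y, hxy⟩ := h.distReg.exists_dist_eq (one_le_two.trans h.two_le_diam)
    have h1 := hF x x
    have h2 := hF x y
    rw [G.dist_self, ← hτ, h0] at h1
    rw [hxy, ← hτ, h0] at h2
    exact h1.symm.trans h2
  · exact mul_ne_zero (mul_ne_zero (pow_ne_zero 2 he)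
      (div_ne_zero h.cast_pos.ne' h.denom_pos.ne')) hn
  · exact mul_ne_zero (pow_ne_zero 2 he) (div_ne_zero h.omega_sq_sub_pos.ne' hf0.ne')
  · ext x y
    have h1 := h.distReg.mul_eq_mul_of_isEigenseq hf h.isEigenseq_omega_sq_sub
      (h.distReg.dist_le x y)
    have h2 : ω (G.dist x y) ^ 2 = s / (b 0 * (s - 1) + s) +
        (ω 0 ^ 2 - s / (b 0 * (s - 1) + s)) / f 0 * f (G.dist x y) := by
      rw [div_mul_eq_mul_div, ← sub_eq_iff_eq_add', eq_div_iff hf0.ne']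
      linear_combination h1
    rw [Matrix.hadamard_apply, Matrix.add_apply, Matrix.smul_apply, Matrix.smul_apply, hE, hF, E₀,
      Matrix.smul_apply, Matrix.of_apply, smul_eq_mul, smul_eq_mul, smul_eq_mul, mul_one,
      mul_inv_cancel_right₀ hn]
    linear_combination e ^ 2 * h2

end IsTailGram

end Tail

end LightTail

theorem mainTheorem4 {V : Type*} [Fintype V] [DecidableEq V]
    (G : SimpleGraph V) [DecidableRel G.Adj] (D : ℕ) (b c : ℕ → ℕ)
    (hG : LightTail.IsDistanceRegular G D b c)
    (k a₁ : ℕ) (hk : k = b 0) (ha₁ : a₁ = LightTail.interA b c 1)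
    (hk3 : 3 ≤ k) (hD : 2 ≤ D) (ha₁0 : a₁ ≠ 0)
    -- the distinct eigenvalues are `θ 0 > θ 1 > ⋯ > θ D`
    (θ : ℕ → ℝ) (hθ : StrictAntiOn θ (Set.Iic D))
    (hθG : θ '' Set.Iic D = LightTail.eigenvalues G)
    (hθD : θ D = -(k : ℝ) / (a₁ + 1))
    (hc₂ : c 2 = (a₁ + 1) ^ 2 + 1)
    (hGQ : ∃ S : Set V, LightTail.IsGQ (G.induce S) (a₁ + 1) (c 2 - 1)) :
    θ 1 = ((k : ℝ) - (a₁ + 1) * (a₁ + 2)) / (a₁ + 1) ^ 2 ∧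
      LightTail.IsLightTailWith G (LightTail.minimalIdempotent G (θ D))
        (LightTail.minimalIdempotent G (θ 1)) := by
  have hG0 : θ D ∈ LightTail.eigenvalues G := hθG ▸ ⟨D, Set.mem_Iic.2 le_rfl, rfl⟩
  obtain ⟨f, hf, hE, hf0⟩ := hG.exists_minimalIdempotent_apply_pos hG0
  have h : LightTail.IsTailGram G D b c (a₁ + 1) (fun i => (f 0)⁻¹ * f i)
      ((f 0)⁻¹ • LightTail.minimalIdempotent G (θ D)) :=
    { distReg := hG
      two_le_diam := hD
      one_lt := by omega
      interA_one := by rw [ha₁]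
      c_two := hc₂
      posSemidef := (LightTail.minimalIdempotent_posSemidef _).smul (inv_nonneg.2 hf0.le)
      apply_eq := fun x y => by rw [Matrix.smul_apply, hE, smul_eq_mul]
      omega_zero := inv_mul_cancel₀ hf0.ne'
      eigenseq := fun i hi => by
        have h1 := hf i hi
        rw [hθD, hk] at h1
        push_cast
        linear_combination (f 0)⁻¹ * h1 }
  have hθ1 := h.second_eigenvalue_eq hθ hθG
  refine ⟨?_, ?_⟩
  · rw [hθ1, hk]
    push_cast
    ring
  · rw [hθ1]
    exact h.isLightTailWith hG0 hf0.ne' fun x y => by rw [hE, mul_inv_cancel_left₀ hf0.ne']
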